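/- Corollary (Any sequence of QCA satisfies an area law). Let $D,d,r$ be natural numbers and fix boundary conditions (open or periodic). For $M\ge 4$ let $G_M=(V_M,E_M)$ be the nearest-neighbour graph of the $D$-dimensional lattice with $V_M=\{0,\dots,M-1\}^D$, where two distinct sites are joined by an edge if they differ in exactly one coordinate, and there by $\pm1$ (open boundary conditions) or by $\pm1$ modulo $M$ (periodic boundary conditions); let $\delta$ be the graph distance, and place a qudit of Hilbert space $\mathbb C^d$ at every site. For $A\subseteq V_M$ let $a_r=\{n\in V_M\setminus A:\delta(n,A)\le r\}$, $\bar A_r=A\cup a_r$, $b_r=a_{2r}\setminus a_r$ and $B_r=V_M\setminus(\bar A_r\cup b_r)$. A quantum cellular automaton (QCA) of range $r$ on $G_M$ (where $r\le M/4$) is a unitary channel $\mathcal E(X)=UXU^\dagger$ ($U$ a unitary on $\bigotimes_{n\in V_M}\mathbb C^d$) such that, for every $A\subseteq V_M$ with $B_r\neq\emptyset$ and every operator $X_A$ supported on $A$, the operator $\mathcal E^\dagger(X_A)$ is supported on $\bar A_r$, where $\mathcal E^\dagger$ is the adjoint of $\mathcal E$ with respect to the Hilbert–Schmidt inner product. Let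 $(\mathcal E_M)$, with $M\ge4$ and $M\ge 4r$, be any sequence in which $\mathcal E_M$ is a QCA of range $r$ on $G_M$. Then there is a constant $c$, independent of $M$, such that for all $M\ge 4$ with $M\ge 4r$, all $A\subseteq V_M$ and all pure product states $|\Psi\rangle=\bigotimes_{n\in V_M}|\varphi_n\rangle$ with unit vectors $|\varphi_n\rangle\in\mathbb C^d$, $$E(A:A^c)\le c\,|\partial A| ,$$ where $E(A:A^c)$ is the entanglement entropy between $A$ and $A^c=V_M\setminus A$ of the state $\mathcal E_M(|\Psi\rangle\langle\Psi|)$, i.e. the von Neumann entropy $-\mathrm{tr}(\rho_A\log_2\rho_A)$ of its reduced state $\rho_A$ on $A$, and $|\partial A|$ is the number of edges between $A$ and $A^c$. (For $r=1$ the sequence is indexed by all $M\ge4$.) -/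

import Mathlib

open scoped Matrix ComplexOrder

noncomputable section

namespace QCA

/-! ### The lattice and the geometry of its regions -/

/-- Boundary conditions of the lattice. -/
inductive Boundary where
  | isOpen
  | periodic

/-- The `M ^ D` sites of the `D`-dimensional lattice of side `M`. -/
abbrev Site (D M : ℕ) : Type := Fin D → Fin M

/-- `n` and `m` differ in exactly one coordinate, and there by one unit: with open boundary
conditions this is `|n - m| = 1`, with periodic ones the unit step is taken modulo `M`. -/
def Neighbours {D M : ℕ} : Boundary → Site D M → Site D M → Prop
  | .isOpen, n, m =>
      ∃ i, (∀ j, j ≠ i → n j = m j) ∧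
        ((n i : ℕ) + 1 = (m i : ℕ) ∨ (m i : ℕ) + 1 = (n i : ℕ))
  | .periodic, n, m =>
      ∃ i, (∀ j, j ≠ i → n j = m j) ∧
        (((n i : ℕ) + 1) % M = (m i : ℕ) ∨ ((m i : ℕ) + 1) % M = (n i : ℕ))

theorem Neighbours.symm {D M : ℕ} {bc : Boundary} {n m : Site D M}
    (h : Neighbours bc n m) : Neighbours bc m n := by
  cases bc <;> obtain ⟨i, h₁, h₂⟩ := h <;>
    exact ⟨i, fun j hj => (h₁ j hj).symm, h₂.symm⟩

/-- The nearest-neighbour graph of the lattice. -/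
def lattice (bc : Boundary) (D M : ℕ) : SimpleGraph (Site D M) where
  Adj n m := n ≠ m ∧ Neighbours bc n m
  symm := ⟨fun _ _ h => ⟨h.1.symm, h.2.symm⟩⟩
  loopless := ⟨fun _ h => h.1 rfl⟩

section Regions

variable {V : Type} [Fintype V] [DecidableEq V] (G : SimpleGraph V)

open Classical in
/-- `a_r`: the sites outside `A` at graph distance at most `r` from `A`. -/
def nbhd (r : ℕ) (A : Finset V) : Finset V :=
  Finset.univ.filter fun n => n ∉ A ∧ ∃ m ∈ A, G.edist n m ≤ (r : ℕ∞)

/-- `Ā_r = A ∪ a_r`. -/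
def closedNbhd (r : ℕ) (A : Finset V) : Finset V := A ∪ nbhd G r A

/-- `b_r = a_{2r} \ a_r`. -/
def nextNbhd (r : ℕ) (A : Finset V) : Finset V := nbhd G (2 * r) A \ nbhd G r A

/-- `B_r = V \ (Ā_r ∪ b_r)`. -/
def farRegion (r : ℕ) (A : Finset V) : Finset V :=
  Finset.univ \ (closedNbhd G r A ∪ nextNbhd G r A)

/-- `|∂A|`: the number of edges between `A` and its complement. -/
def boundarySize (A : Finset V) : ℕ :=
  {e : Sym2 V | e ∈ G.edgeSet ∧ ∃ x ∈ A, ∃ y, y ∉ A ∧ e = s(x, y)}.ncard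

end Regions

/-! ### Operators and channels on qudits sitting at the sites -/

section Operators

variable {V : Type} [Fintype V] [DecidableEq V] {d : ℕ}

/-- Operators on `⨂_{v ∈ V} ℂ^d`, written in the computational basis `|s⟩`, `s : V → Fin d`. -/
abbrev Op (V : Type) (d : ℕ) : Type := Matrix (V → Fin d) (V → Fin d) ℂ

/-- `X` is supported on `A`: `X = Y ⊗ 1` with `Y` acting on the qudits of `A` and the identity
acting on the remaining ones. -/
def SupportedOn (A : Finset V) (X : Op V d) : Prop :=
  ∃ Y : Op {v // v ∈ A} d, ∀ s t : V → Fin d,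
    X s t = if ∀ v, v ∉ A → s v = t v then Y (fun v => s v) (fun v => t v) else 0

/-- Trace-preserving and completely positive (`E ⊗ id_k` is positive for every `k`). -/
structure IsQuantumChannel {I : Type} [Fintype I] [DecidableEq I]
    (E : Matrix I I ℂ →ₗ[ℂ] Matrix I I ℂ) : Prop where
  trace_preserving : ∀ X, (E X).trace = X.trace
  completely_positive : ∀ (k : ℕ) (X : Matrix (I × Fin k) (I × Fin k) ℂ), X.PosSemidef →
    (Matrix.of fun p q : I × Fin k =>
      E (Matrix.of fun i j => X (i, p.2) (j, q.2)) p.1 q.1).PosSemidef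

/-- The adjoint `E†` for the Hilbert–Schmidt inner product `⟪X, Y⟫ = tr (Xᴴ Y)`, given by its
matrix entries `(E† X)_{ij} = ⟪E (|i⟩⟨j|), X⟫`. -/
def heisenberg {I : Type} [Fintype I] [DecidableEq I]
    (E : Matrix I I ℂ →ₗ[ℂ] Matrix I I ℂ) (X : Matrix I I ℂ) : Matrix I I ℂ :=
  Matrix.of fun i j => ((E (Matrix.single i j 1))ᴴ * X).trace

/-- The defining property of the Hilbert–Schmidt adjoint. -/
theorem heisenberg_adjoint {I : Type} [Fintype I] [DecidableEq I]
    (E : Matrix I I ℂ →ₗ[ℂ] Matrix I I ℂ) (X Y : Matrix I I ℂ) :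
    ((E Y)ᴴ * X).trace = (Yᴴ * heisenberg E X).trace := by
  have hY : E Y = ∑ i, ∑ j, Y i j • E (Matrix.single i j 1) := by
    conv_lhs => rw [Matrix.matrix_eq_sum_single Y]
    simp only [map_sum]
    refine Finset.sum_congr rfl fun i _ => Finset.sum_congr rfl fun j _ => ?_
    rw [← map_smul]
    simp [Matrix.smul_single]
  rw [hY]
  simp only [Matrix.conjTranspose_sum, Matrix.conjTranspose_smul, Finset.sum_mul,
    Matrix.smul_mul, Matrix.trace_sum, Matrix.trace_smul]
  rw [Finset.sum_comm]
  simp [Matrix.trace, Matrix.mul_apply, heisenberg]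

/-- A causality preserving quantum channel of range `r`: a channel whose Heisenberg picture maps
every operator supported on `A` to an operator supported on `Ā_r`, for all regions `A` such that
`B_r` is not empty. -/
structure IsCPQC (G : SimpleGraph V) (r : ℕ) (E : Op V d →ₗ[ℂ] Op V d) : Prop where
  channel : IsQuantumChannel E
  causal : ∀ A : Finset V, (farRegion G r A).Nonempty →
    ∀ X : Op V d, SupportedOn A X → SupportedOn (closedNbhd G r A) (heisenberg E X)

/-- `E(X) = U X U†` for a unitary `U`. -/
def IsUnitaryChannel {I : Type} [Fintype I] [DecidableEq I]
    (E : Matrix I I ℂ →ₗ[ℂ] Matrix I I ℂ) : Prop :=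
  ∃ U ∈ Matrix.unitaryGroup I ℂ, ∀ X, E X = U * X * Uᴴ

/-- A quantum cellular automaton of range `r`: a unitary causality preserving channel. -/
structure IsQCA (G : SimpleGraph V) (r : ℕ) (E : Op V d →ₗ[ℂ] Op V d) : Prop where
  unitary : IsUnitaryChannel E
  causality_preserving : IsCPQC G r E

/-! ### States and entanglement entropy -/

/-- The density operator `|Ψ⟩⟨Ψ|` of a vector `Ψ`. -/
def pureState (Ψ : (V → Fin d) → ℂ) : Op V d := Matrix.vecMulVec Ψ (star Ψ)

/-- `ρ = |Ψ⟩⟨Ψ|` with `|Ψ⟩ = ⨂_v |φ_v⟩` and unit vectors `|φ_v⟩` in `ℂ^d`. -/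
def IsPureProductState (ρ : Op V d) : Prop :=
  ∃ φ : V → EuclideanSpace ℂ (Fin d), (∀ v, ‖φ v‖ = 1) ∧
    ρ = pureState fun s => ∏ v, φ v (s v)

/-- The configuration equal to `s` on `A` and to `u` on the complement of `A`. -/
def glue (A : Finset V) (s : {v // v ∈ A} → Fin d) (u : {v // v ∉ A} → Fin d) : V → Fin d :=
  fun v => if h : v ∈ A then s ⟨v, h⟩ else u ⟨v, h⟩

/-- The reduced state of the qudits in `A` (the partial trace over the complement of `A`). -/
def reducedState (A : Finset V) (ρ : Op V d) : Op {v // v ∈ A} d :=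
  Matrix.of fun s t => ∑ u : {v // v ∉ A} → Fin d, ρ (glue A s u) (glue A t u)

open Classical in
/-- The von Neumann entropy `-tr (ρ log₂ ρ) = -∑ λ log₂ λ` of a Hermitian `ρ`, the sum running
over the eigenvalues of `ρ` with multiplicity (the value for non-Hermitian `ρ` is irrelevant). -/
def vonNeumannEntropy {I : Type} [Fintype I] [DecidableEq I] (ρ : Matrix I I ℂ) : ℝ :=
  if h : ρ.IsHermitian then -∑ i, h.eigenvalues i * Real.logb 2 (h.eigenvalues i) else 0

/-- The entanglement entropy, in a pure state `ρ`, between the qudits in `A` and those in the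
complement of `A`: the von Neumann entropy of the reduced state of `A`. -/
def entanglementEntropy (A : Finset V) (ρ : Op V d) : ℝ :=
  vonNeumannEntropy (reducedState A ρ)

end Operators

end QCA

end

/-!
The reduced state `ρ_A` of `U Ψ`, `Ψ` a product vector, has small rank, and the entropy of a
density matrix is at most the logarithm of its rank (`vonNeumannEntropy_le_logb`).

The rank is bounded by a dimension count. Write `F` for the coefficient matrix of `U Ψ` with rows
indexed by the configurations of `A`, so that `ρ_A = F Fᴴ` and `rank ρ_A = rank F`. The vectors
`(X ⊗ 1) U Ψ`, with `X` running over the operators on `A`, have coefficient matrices `X F`, i.e. all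
matrices with rows in the row space of `F`; they form a space of dimension `d ^ |A| * rank F`. On
the other hand `Uᴴ (X ⊗ 1) U` is supported on `Ā_r`, so that applying `Uᴴ` sends these vectors into
`H_{Ā_r} ⊗ ⨂_{v ∉ Ā_r} φ_v`, which has dimension `d ^ |Ā_r| = d ^ |A| * d ^ |a_r|`. Hence
`rank F ≤ d ^ |a_r|` (`pow_card_mul_rank_schmidtMatrix_le`). Causality is only available when `B_r`
is nonempty; when `B_r` is empty the complement of `A` is contained in `a_{2r}` and has at most
`d ^ |a_{2r}|` configurations. In both cases the entropy is at most `|a_{2r}| log₂ d`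
(`entanglementEntropy_le_card_nbhd`).

Finally `|a_{2r}|` is at most a constant times `|∂A|` (`card_nbhd_le`): every site of `a_{2r}` lies
within distance `2r` of the outer endpoint of a boundary edge, and since sites have at most `2D`
neighbours, balls of radius `R` have at most `(2D + 1) ^ R` sites, independently of `M`.
-/

namespace QCA

/-! ### Counting sites near the boundary of a region -/

theorem exists_crossing_edge {V : Type} (G : SimpleGraph V) (A : Finset V) {n m : V}
    (p : G.Walk n m) (hn : n ∉ A) (hm : m ∈ A) :
    ∃ x ∈ A, ∃ y, y ∉ A ∧ G.Adj x y ∧ ∃ q : G.Walk n y, q.length ≤ p.length := by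
  induction p with
  | nil => exact absurd hm hn
  | @cons u z w h q ih =>
    by_cases hz : z ∈ A
    · exact ⟨z, hz, u, hn, h.symm, .nil, by simp⟩
    · obtain ⟨x, hx, y, hy, hxy, q', hq'⟩ := ih hz hm
      exact ⟨x, hx, y, hy, hxy, .cons h q', by simpa using hq'⟩

section Counting

variable {V : Type} [Fintype V] [DecidableEq V] (G : SimpleGraph V)

open Classical in
/-- The closed ball of radius `R` around `y`, described by walks. -/
noncomputable def walkBall (R : ℕ) (y : V) : Finset V :=
  Finset.univ.filter fun n => ∃ p : G.Walk n y, p.length ≤ R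

open Classical in
theorem card_walkBall_le {Δ : ℕ} (hΔ : ∀ n, (Finset.univ.filter fun m => G.Adj n m).card ≤ Δ)
    (R : ℕ) (y : V) : (walkBall G R y).card ≤ (Δ + 1) ^ R := by
  induction R with
  | zero =>
    rw [pow_zero, Finset.card_le_one]
    intro a ha b hb
    simp only [walkBall, Finset.mem_filter, Finset.mem_univ, true_and] at ha hb
    obtain ⟨p, hp⟩ := ha
    obtain ⟨q, hq⟩ := hb
    rw [SimpleGraph.Walk.eq_of_length_eq_zero (Nat.le_zero.mp hp),
      SimpleGraph.Walk.eq_of_length_eq_zero (Nat.le_zero.mp hq)]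
  | succ R ih =>
    have hsub : walkBall G (R + 1) y ⊆ (walkBall G R y).biUnion
        fun z => insert z (Finset.univ.filter fun m => G.Adj z m) := by
      intro n hn
      simp only [walkBall, Finset.mem_filter, Finset.mem_univ, true_and, Finset.mem_biUnion,
        Finset.mem_insert] at hn ⊢
      obtain ⟨p, hp⟩ := hn
      cases p with
      | nil => exact ⟨y, ⟨.nil, Nat.zero_le R⟩, Or.inl rfl⟩
      | @cons _ z _ h q =>
        refine ⟨z, ⟨q, ?_⟩, Or.inr h.symm⟩
        simpa using hp
    calc (walkBall G (R + 1) y).card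
        ≤ (walkBall G R y).card * (Δ + 1) :=
          (Finset.card_le_card hsub).trans <| Finset.card_biUnion_le_card_mul _ _ _ fun z _ =>
            (Finset.card_insert_le _ _).trans (Nat.succ_le_succ (hΔ z))
      _ ≤ (Δ + 1) ^ (R + 1) := by
          rw [pow_succ]
          exact Nat.mul_le_mul_right _ ih

open Classical in
/-- A shortest path from a site near `A` to `A` crosses the boundary, so the balls around the outer
endpoints of the boundary edges cover the neighbourhood of `A`. -/
theorem card_nbhd_le {Δ : ℕ} (hΔ : ∀ n, (Finset.univ.filter fun m => G.Adj n m).card ≤ Δ)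
    (R : ℕ) (A : Finset V) : (nbhd G R A).card ≤ boundarySize G A * (Δ + 1) ^ R := by
  set S : Set (Sym2 V) := {e | e ∈ G.edgeSet ∧ ∃ x ∈ A, ∃ y, y ∉ A ∧ e = s(x, y)} with hS
  -- the sites outside `A` lying on a boundary edge: there are at most as many as boundary edges
  set T : Finset V := Finset.univ.filter fun y => y ∉ A ∧ ∃ x ∈ A, G.Adj x y with hT
  have hTS : T.card ≤ boundarySize G A := by
    have hchoice : ∀ y ∈ T, ∃ x ∈ A, G.Adj x y := fun y hy => (Finset.mem_filter.mp hy).2.2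
    choose! f hfA hf using hchoice
    rw [← Set.ncard_coe_finset T]
    refine Set.ncard_le_ncard_of_injOn (fun y => s(f y, y)) ?_ ?_ (Set.toFinite S)
    · intro y hy
      have hyA : y ∉ A := (Finset.mem_filter.mp hy).2.1
      exact ⟨hf y hy, f y, hfA y hy, y, hyA, rfl⟩
    · intro y hy z hz hyz
      have hyA : y ∉ A := (Finset.mem_filter.mp hy).2.1
      rcases Sym2.eq_iff.mp hyz with h | h
      · exact h.2
      · exact absurd (h.2 ▸ hfA z hz) hyA
  have hcover : nbhd G R A ⊆ T.biUnion (walkBall G R) := by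
    intro n hn
    simp only [nbhd, Finset.mem_filter, Finset.mem_univ, true_and] at hn
    obtain ⟨hnA, m, hmA, hdist⟩ := hn
    obtain ⟨p, hp⟩ := SimpleGraph.exists_walk_of_edist_ne_top
      (ne_top_of_le_ne_top (ENat.natCast_ne_top R) hdist)
    have hpR : p.length ≤ R := by
      rw [← hp] at hdist
      exact_mod_cast hdist
    obtain ⟨x, hx, y, hy, hxy, q, hq⟩ := exists_crossing_edge G A p hnA hmA
    simp only [Finset.mem_biUnion, walkBall, Finset.mem_filter, Finset.mem_univ, true_and, hT]
    exact ⟨y, ⟨hy, x, hx, hxy⟩, q, hq.trans hpR⟩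
  calc (nbhd G R A).card ≤ T.card * (Δ + 1) ^ R :=
        (Finset.card_le_card hcover).trans <|
          Finset.card_biUnion_le_card_mul _ _ _ fun y _ => card_walkBall_le G hΔ R y
    _ ≤ _ := Nat.mul_le_mul_right _ hTS

theorem nbhd_mono {r R : ℕ} (h : r ≤ R) (A : Finset V) : nbhd G r A ⊆ nbhd G R A := by
  classical
  intro n hn
  simp only [nbhd, Finset.mem_filter, Finset.mem_univ, true_and] at hn ⊢
  obtain ⟨hnA, m, hmA, hd⟩ := hn
  exact ⟨hnA, m, hmA, hd.trans (by exact_mod_cast h)⟩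

theorem card_closedNbhd (r : ℕ) (A : Finset V) :
    (closedNbhd G r A).card = A.card + (nbhd G r A).card := by
  classical
  refine Finset.card_union_of_disjoint (Finset.disjoint_left.mpr fun n hn hn' => ?_)
  simp only [nbhd, Finset.mem_filter, Finset.mem_univ, true_and] at hn'
  exact hn'.1 hn

theorem compl_subset_nbhd_of_farRegion_eq_empty {r : ℕ} {A : Finset V}
    (h : farRegion G r A = ∅) : Aᶜ ⊆ nbhd G (2 * r) A := by
  intro n hn
  have hn' : n ∈ closedNbhd G r A ∪ nextNbhd G r A := by
    by_contra hcon
    have : n ∈ farRegion G r A := Finset.mem_sdiff.mpr ⟨Finset.mem_univ n, hcon⟩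
    simp [h] at this
  simp only [closedNbhd, nextNbhd, Finset.mem_union, Finset.mem_sdiff] at hn'
  rcases hn' with (hA | hr) | hb
  · exact absurd hA (Finset.mem_compl.mp hn)
  · exact nbhd_mono G (by omega) A hr
  · exact hb.1

end Counting

open Classical in
theorem card_lattice_neighbours_le (bc : Boundary) (D M : ℕ) (n : Site D M) :
    (Finset.univ.filter fun m => (lattice bc D M).Adj n m).card ≤ 2 * D := by
  -- a neighbour is determined by the coordinate that changes and the direction of the step
  have hcode : ∀ m, (lattice bc D M).Adj n m → ∃ c : Fin D × Bool,
      (∀ j, j ≠ c.1 → n j = m j) ∧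
        (match bc with
          | .isOpen => if c.2 then (n c.1 : ℕ) + 1 = m c.1 else (m c.1 : ℕ) + 1 = n c.1
          | .periodic => if c.2 then ((n c.1 : ℕ) + 1) % M = m c.1
              else ((m c.1 : ℕ) + 1) % M = n c.1) := by
    intro m hm
    cases bc <;> obtain ⟨-, i, hi, h | h⟩ := hm
    · exact ⟨(i, true), hi, by simpa using h⟩
    · exact ⟨(i, false), hi, by simpa using h⟩
    · exact ⟨(i, true), hi, by simpa using h⟩
    · exact ⟨(i, false), hi, by simpa using h⟩
  have hcard : (Finset.univ : Finset (Fin D × Bool)).card = 2 * D := by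
    simp [mul_comm]
  rw [← hcard]
  refine Finset.card_le_card_of_forall_subsingleton _ (fun m hm =>
    (hcode m (Finset.mem_filter.mp hm).2).imp fun c hc => ⟨Finset.mem_univ c, hc⟩) ?_
  rintro ⟨i, b⟩ - m ⟨-, h₁, k₁⟩ m' ⟨-, h₂, k₂⟩
  funext j
  by_cases hj : j = i
  · subst hj
    apply Fin.ext
    have b₁ := (m j).isLt
    have b₂ := (m' j).isLt
    cases bc <;> cases b <;> simp only [Bool.false_eq_true, if_true, if_false] at k₁ k₂
    · omega
    · omega
    · have hmod : (m j : ℕ) ≡ m' j [MOD M] := Nat.ModEq.add_right_cancel' 1 (k₁.trans k₂.symm)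
      rwa [Nat.ModEq, Nat.mod_eq_of_lt b₁, Nat.mod_eq_of_lt b₂] at hmod
    · omega
  · rw [← h₁ j hj, h₂ j hj]

/-! ### Entropy and rank -/

/-- The entropy of a density matrix whose rank is at most `K` is at most `log₂ K`. This is
`log x ≤ x - 1` applied to `x = (λ K)⁻¹` for the nonzero eigenvalues `λ`. -/
theorem vonNeumannEntropy_le_logb {I : Type} [Fintype I] [DecidableEq I] {ρ : Matrix I I ℂ}
    (hρ : ρ.PosSemidef) (htr : ρ.trace = 1) {K : ℕ} (hK : ρ.rank ≤ K) :
    vonNeumannEntropy ρ ≤ Real.logb 2 K := by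
  classical
  have hH := hρ.isHermitian
  set lam := hH.eigenvalues with hlam
  have hnn : ∀ i, 0 ≤ lam i := fun i => hρ.eigenvalues_nonneg i
  have hsum : ∑ i, lam i = 1 := by
    have h := hH.trace_eq_sum_eigenvalues
    rw [htr] at h
    have h' : ((∑ i, lam i : ℝ) : ℂ) = 1 := by
      push_cast
      exact h.symm
    exact_mod_cast h'
  have hcard : ((Finset.univ.filter fun i => lam i ≠ 0).card : ℝ) ≤ K := by
    have h := hH.rank_eq_card_non_zero_eigs
    rw [Fintype.card_subtype] at h
    rw [h] at hK
    exact_mod_cast hK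
  have hKpos : (0 : ℝ) < K := by
    obtain ⟨i, -, hi⟩ : ∃ i ∈ Finset.univ, lam i ≠ 0 :=
      Finset.exists_ne_zero_of_sum_ne_zero (by rw [hsum]; exact one_ne_zero)
    refine lt_of_lt_of_le ?_ hcard
    exact_mod_cast Finset.card_pos.mpr ⟨i, by simpa using hi⟩
  have hterm : ∀ i, -(lam i * Real.log (lam i)) - lam i * Real.log K ≤
      (if lam i ≠ 0 then (K : ℝ)⁻¹ else 0) - lam i := by
    intro i
    by_cases hi : lam i = 0
    · simp [hi]
    · have hpos : 0 < lam i := lt_of_le_of_ne (hnn i) (Ne.symm hi)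
      have hlog := Real.log_le_sub_one_of_pos (inv_pos.mpr (mul_pos hpos hKpos))
      rw [Real.log_inv, Real.log_mul hi hKpos.ne'] at hlog
      have h := mul_le_mul_of_nonneg_left hlog hpos.le
      have hinv : lam i * ((lam i * K)⁻¹ - 1) = (K : ℝ)⁻¹ - lam i := by
        field_simp
      rw [hinv] at h
      rw [if_pos hi]
      linarith
  have htot : -∑ i, lam i * Real.log (lam i) ≤ Real.log K := by
    have h := Finset.sum_le_sum fun i (_ : i ∈ Finset.univ) => hterm i
    rw [Finset.sum_sub_distrib, Finset.sum_sub_distrib, ← Finset.sum_mul, hsum,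
      Finset.sum_neg_distrib, ← Finset.sum_filter, Finset.sum_const, nsmul_eq_mul] at h
    have h' : ((Finset.univ.filter fun i => lam i ≠ 0).card : ℝ) * (K : ℝ)⁻¹ ≤ 1 := by
      rw [← div_eq_mul_inv, div_le_one hKpos]
      exact hcard
    linarith
  have hlog2 : 0 < Real.log 2 := Real.log_pos one_lt_two
  rw [vonNeumannEntropy, dif_pos hH]
  calc -∑ i, lam i * Real.logb 2 (lam i)
      = (-∑ i, lam i * Real.log (lam i)) / Real.log 2 := by
        simp only [Real.logb, neg_div, Finset.sum_div, mul_div_assoc]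
    _ ≤ Real.log K / Real.log 2 := by gcongr
    _ = Real.logb 2 K := rfl

/-- The matrices `X * F` are those whose rows lie in the row space of `F`; hence they form a space
of dimension at least (in fact equal to) the number of rows times the rank of `F`. -/
theorem card_mul_rank_le_finrank {m n : Type} [Fintype m] [DecidableEq m] [Fintype n]
    [DecidableEq n] (F : Matrix m n ℂ) (W : Submodule ℂ (Matrix m n ℂ))
    (hW : ∀ X : Matrix m m ℂ, X * F ∈ W) : Fintype.card m * F.rank ≤ Module.finrank ℂ W := by
  set R : Submodule ℂ (n → ℂ) := LinearMap.range F.vecMulLinear with hR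
  have hrank : Module.finrank ℂ R = F.rank := by
    rw [← Matrix.rank_transpose, Matrix.rank, hR, Matrix.mulVecLin_transpose]
  have hmem : ∀ w : m → R, (Matrix.of fun i => (w i : n → ℂ)) ∈ W := by
    intro w
    have hw : ∀ i, ∃ x : m → ℂ, Matrix.vecMul x F = w i := fun i => (w i).2
    choose x hx using hw
    convert hW (Matrix.of x) using 1
    ext i j
    rw [Matrix.of_apply, ← hx i]
    rfl
  let T : (m → R) →ₗ[ℂ] W :=
    { toFun := fun w => ⟨Matrix.of fun i => (w i : n → ℂ), hmem w⟩
      map_add' := fun _ _ => rfl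
      map_smul' := fun _ _ => rfl }
  have hT : Function.Injective T := by
    intro w w' h
    funext i
    apply Subtype.ext
    funext j
    exact congrFun (congrFun (congrArg Subtype.val h) i) j
  calc Fintype.card m * F.rank = Module.finrank ℂ (m → R) := by
        rw [Module.finrank_pi_fintype, Finset.sum_const, Finset.card_univ, smul_eq_mul, hrank]
    _ ≤ _ := LinearMap.finrank_le_finrank_of_injective hT

/-! ### The Schmidt rank of a product state evolved by a unitary -/

@[simp]
theorem glue_mem {V : Type} [DecidableEq V] {d : ℕ} (A : Finset V)
    (s : {v // v ∈ A} → Fin d) (u : {v // v ∉ A} → Fin d) (v : {v // v ∈ A}) : glue A s u v = s v := by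
  simp [glue]

@[simp]
theorem glue_notMem {V : Type} [DecidableEq V] {d : ℕ} (A : Finset V)
    (s : {v // v ∈ A} → Fin d) (u : {v // v ∉ A} → Fin d) (v : {v // v ∉ A}) : glue A s u v = u v := by
  simp [glue, v.2]

section Schmidt

variable {V : Type} [Fintype V] [DecidableEq V] {d : ℕ}

/-- The operator `X ⊗ 1` with `X` acting on the qudits of `A`. -/
def localOp (A : Finset V) (X : Op {v // v ∈ A} d) : Op V d :=
  Matrix.of fun s t => if ∀ v, v ∉ A → s v = t v then X (fun v => s v) (fun v => t v) else 0

theorem supportedOn_localOp (A : Finset V) (X : Op {v // v ∈ A} d) :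
    SupportedOn A (localOp A X) := ⟨X, fun _ _ => rfl⟩

/-- The coefficients of `Φ` as a matrix whose rows are indexed by the configurations of `A` and
whose columns by those of its complement. -/
def schmidtMatrix (A : Finset V) :
    ((V → Fin d) → ℂ) →ₗ[ℂ] Matrix ({v // v ∈ A} → Fin d) ({v // v ∉ A} → Fin d) ℂ where
  toFun Φ := Matrix.of fun s u => Φ (glue A s u)
  map_add' _ _ := rfl
  map_smul' _ _ := rfl

@[simp]
theorem schmidtMatrix_apply {V : Type} [DecidableEq V] {d : ℕ} (A : Finset V)
    (Φ : (V → Fin d) → ℂ) (s : {v // v ∈ A} → Fin d) (u : {v // v ∉ A} → Fin d) :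
    schmidtMatrix A Φ s u = Φ (glue A s u) := rfl

theorem sum_eq_sum_glue (A : Finset V) (f : (V → Fin d) → ℂ) :
    ∑ t, f t = ∑ s : {v // v ∈ A} → Fin d, ∑ u : {v // v ∉ A} → Fin d, f (glue A s u) := by
  rw [← Fintype.sum_prod_type', ← (Equiv.piEquivPiSubtypeProd (· ∈ A) fun _ => Fin d).symm.sum_comp]
  rfl

/-- Summing over the configurations that agree with `s` off `A` amounts to summing over the
configurations of `A`. -/
theorem sum_ite_eq_off (A : Finset V) (s : V → Fin d) (f : (V → Fin d) → ℂ) :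
    (∑ t, if ∀ v, v ∉ A → s v = t v then f t else 0) =
      ∑ t : {v // v ∈ A} → Fin d, f (glue A t fun v => s v) := by
  rw [sum_eq_sum_glue A]
  refine Finset.sum_congr rfl fun t _ => ?_
  have h : ∀ u : {v // v ∉ A} → Fin d,
      (∀ v, v ∉ A → s v = glue A t u v) ↔ (fun v : {v // v ∉ A} => s v) = u := by
    intro u
    constructor
    · intro h
      funext v
      rw [h v v.2, glue_notMem]
    · rintro rfl v hv
      exact (glue_notMem A t (fun v => s v) ⟨v, hv⟩).symm
  simp only [h, Finset.sum_ite_eq, Finset.mem_univ, if_true]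

theorem schmidtMatrix_localOp_mulVec (A : Finset V) (X : Op {v // v ∈ A} d)
    (Φ : (V → Fin d) → ℂ) :
    schmidtMatrix A (localOp A X *ᵥ Φ) = X * schmidtMatrix A Φ := by
  ext s u
  simp only [schmidtMatrix_apply, Matrix.of_apply, Matrix.mulVec, dotProduct, localOp,
    Matrix.mul_apply, ite_mul, zero_mul]
  rw [sum_ite_eq_off]
  simp

theorem reducedState_pureState (A : Finset V) (Φ : (V → Fin d) → ℂ) :
    reducedState A (pureState Φ) = schmidtMatrix A Φ * (schmidtMatrix A Φ)ᴴ := by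
  ext s t
  simp [reducedState, pureState, Matrix.mul_apply, Matrix.vecMulVec_apply]

theorem trace_reducedState (A : Finset V) (ρ : Op V d) : (reducedState A ρ).trace = ρ.trace := by
  simp only [Matrix.trace, Matrix.diag_apply, reducedState, Matrix.of_apply]
  exact (sum_eq_sum_glue A fun t => ρ t t).symm

theorem trace_pureState_prod (φ : V → EuclideanSpace ℂ (Fin d)) (hφ : ∀ v, ‖φ v‖ = 1) :
    (pureState fun s => ∏ v, φ v (s v)).trace = 1 := by
  have h : ∀ v, ∑ i, φ v i * star (φ v i) = 1 := by
    intro v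
    have h := EuclideanSpace.norm_sq_eq (φ v)
    rw [hφ v] at h
    have h' : ((∑ i, ‖φ v i‖ ^ 2 : ℝ) : ℂ) = 1 := by
      rw [← h]
      simp
    rw [← h']
    push_cast
    exact Finset.sum_congr rfl fun i _ => Complex.mul_conj' _
  simp only [Matrix.trace, Matrix.diag_apply, pureState, Matrix.vecMulVec_apply, Pi.star_apply,
    star_prod, ← Finset.prod_mul_distrib]
  rw [← Fintype.piFinset_univ,
    ← Finset.prod_univ_sum (fun _ => Finset.univ) fun v i => φ v i * star (φ v i)]
  exact Finset.prod_eq_one fun v _ => h v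

theorem heisenberg_unitaryConj {I : Type} [Fintype I] [DecidableEq I]
    (E : Matrix I I ℂ →ₗ[ℂ] Matrix I I ℂ) (U : Matrix I I ℂ) (hE : ∀ X, E X = U * X * Uᴴ)
    (X : Matrix I I ℂ) : heisenberg E X = Uᴴ * X * U := by
  ext i j
  rw [heisenberg, Matrix.of_apply, hE]
  have h : (U * Matrix.single i j 1 * Uᴴ)ᴴ * X = U * (Matrix.single j i 1 * (Uᴴ * X)) := by
    simp [Matrix.conjTranspose_mul, Matrix.mul_assoc]
  rw [h, Matrix.trace_mul_comm, Matrix.mul_assoc, Matrix.trace_single_mul]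
  simp

theorem unitaryConj_pureState (U : Op V d) (Ψ : (V → Fin d) → ℂ) :
    U * pureState Ψ * Uᴴ = pureState (U *ᵥ Ψ) := by
  rw [pureState, pureState, Matrix.mul_vecMulVec, Matrix.vecMulVec_mul, Matrix.star_mulVec]

/-- The embedding `g ↦ g ⊗ ⨂_{v ∉ A} φ_v` of the vectors of the qudits in `A`. -/
def tensorProd (A : Finset V) (φ : V → Fin d → ℂ) :
    (({v // v ∈ A} → Fin d) → ℂ) →ₗ[ℂ] ((V → Fin d) → ℂ) where
  toFun g s := g (fun v => s v) * ∏ v : {v // v ∉ A}, φ v (s v)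
  map_add' g h := by
    funext s
    simp [add_mul]
  map_smul' c g := by
    funext s
    simp [mul_assoc]

theorem mulVec_prod_mem_range_tensorProd {A : Finset V} {Z : Op V d} (hZ : SupportedOn A Z)
    (φ : V → Fin d → ℂ) :
    (Z *ᵥ fun s => ∏ v, φ v (s v)) ∈ LinearMap.range (tensorProd A φ) := by
  obtain ⟨Y, hY⟩ := hZ
  refine ⟨fun s => ∑ t, Y s t * ∏ v : {v // v ∈ A}, φ v (t v), ?_⟩
  funext s
  simp only [tensorProd, LinearMap.coe_mk, AddHom.coe_mk, Matrix.mulVec, dotProduct, hY, ite_mul,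
    zero_mul]
  rw [sum_ite_eq_off, Finset.sum_mul]
  refine Finset.sum_congr rfl fun t _ => ?_
  rw [← Fintype.prod_subtype_mul_prod_subtype (· ∈ A)]
  simp only [glue_mem, glue_notMem, mul_assoc]
  congr!

/-- If the Heisenberg evolution by `U` maps operators supported on `A` to operators supported on
`B`, then `Uᴴ (X ⊗ 1) U Ψ` lies, for a product vector `Ψ`, in a space of dimension `d ^ |B|`,
whereas the vectors `(X ⊗ 1) U Ψ` span a space of dimension `d ^ |A|` times the Schmidt rank of
`U Ψ`. -/
theorem pow_card_mul_rank_schmidtMatrix_le {A B : Finset V} {U : Op V d}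
    (hU : U ∈ Matrix.unitaryGroup (V → Fin d) ℂ)
    (hAB : ∀ X : Op V d, SupportedOn A X → SupportedOn B (Uᴴ * X * U)) (φ : V → Fin d → ℂ) :
    d ^ A.card * (schmidtMatrix A (U *ᵥ fun s => ∏ v, φ v (s v))).rank ≤ d ^ B.card := by
  set Ψ : (V → Fin d) → ℂ := fun s => ∏ v, φ v (s v) with hΨ
  set W := (LinearMap.range (tensorProd B φ)).map (schmidtMatrix A ∘ₗ U.mulVecLin) with hWdef
  have hW : ∀ X : Op {v // v ∈ A} d, X * schmidtMatrix A (U *ᵥ Ψ) ∈ W := by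
    intro X
    refine ⟨(Uᴴ * localOp A X * U) *ᵥ Ψ,
      mulVec_prod_mem_range_tensorProd (hAB _ (supportedOn_localOp A X)) φ, ?_⟩
    have hUU : U * Uᴴ = 1 := Matrix.mem_unitaryGroup_iff.mp hU
    rw [LinearMap.comp_apply, Matrix.mulVecLin_apply, Matrix.mulVec_mulVec, ← Matrix.mul_assoc,
      ← Matrix.mul_assoc, hUU, Matrix.one_mul, ← Matrix.mulVec_mulVec,
      schmidtMatrix_localOp_mulVec]
  have h := card_mul_rank_le_finrank (schmidtMatrix A (U *ᵥ Ψ)) W hW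
  have hfin : Module.finrank ℂ W ≤ d ^ B.card :=
    calc Module.finrank ℂ W ≤ Module.finrank ℂ (LinearMap.range (tensorProd B φ)) :=
          Submodule.finrank_map_le _ _
      _ ≤ Module.finrank ℂ (({v // v ∈ B} → Fin d) → ℂ) := LinearMap.finrank_range_le _
      _ = d ^ B.card := by simp
  simpa using h.trans hfin

theorem rank_schmidtMatrix_le_pow_card_compl (A : Finset V) (Φ : (V → Fin d) → ℂ) :
    (schmidtMatrix A Φ).rank ≤ d ^ Aᶜ.card := by
  refine (Matrix.rank_le_card_width _).trans (le_of_eq ?_)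
  simp [Fintype.card_subtype_compl, Finset.card_compl]

/-- The area law before counting: a state created from a product state by a QCA of range `r` has
entanglement at most `log₂ d` per site of the neighbourhood `a_{2r}`. -/
theorem entanglementEntropy_le_card_nbhd [Nonempty V] {G : SimpleGraph V} {r : ℕ}
    {E : Op V d →ₗ[ℂ] Op V d} (hE : IsQCA G r E) (A : Finset V) {ρ : Op V d}
    (hρ : IsPureProductState ρ) :
    entanglementEntropy A (E ρ) ≤ (nbhd G (2 * r) A).card * Real.logb 2 d := by
  obtain ⟨U, hU, hEU⟩ := hE.unitary
  obtain ⟨φ, hφ, rfl⟩ := hρ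
  -- a unit vector exists in `ℂ^d`, so `d` is positive
  have hd : 0 < d := by
    rcases Nat.eq_zero_or_pos d with rfl | h
    · obtain ⟨v⟩ := ‹Nonempty V›
      have h0 : φ v = 0 := Subsingleton.elim _ _
      have h1 := hφ v
      rw [h0, norm_zero] at h1
      exact absurd h1 zero_ne_one
    · exact h
  set Ψ : (V → Fin d) → ℂ := fun s => ∏ v, φ v (s v) with hΨ
  have hrank : (schmidtMatrix A (U *ᵥ Ψ)).rank ≤ d ^ (nbhd G (2 * r) A).card := by
    rcases (farRegion G r A).eq_empty_or_nonempty with hfar | hfar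
    · exact (rank_schmidtMatrix_le_pow_card_compl A _).trans <| Nat.pow_le_pow_right hd <|
        Finset.card_le_card (compl_subset_nbhd_of_farRegion_eq_empty G hfar)
    · have h := pow_card_mul_rank_schmidtMatrix_le (B := closedNbhd G r A) hU (fun X hX => by
        rw [← heisenberg_unitaryConj E U hEU]
        exact hE.causality_preserving.causal A hfar X hX) fun v i => φ v i
      rw [card_closedNbhd, pow_add] at h
      exact (Nat.le_of_mul_le_mul_left h (Nat.pow_pos hd)).trans <| Nat.pow_le_pow_right hd <|
        Finset.card_le_card (nbhd_mono G (by omega) A)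
  have hstate : reducedState A (E (pureState Ψ)) =
      schmidtMatrix A (U *ᵥ Ψ) * (schmidtMatrix A (U *ᵥ Ψ))ᴴ := by
    rw [hEU, unitaryConj_pureState, reducedState_pureState]
  have htr : (reducedState A (E (pureState Ψ))).trace = 1 := by
    rw [trace_reducedState, hE.causality_preserving.channel.trace_preserving]
    exact trace_pureState_prod φ hφ
  have hpos : (reducedState A (E (pureState Ψ))).PosSemidef := by
    rw [hstate]
    exact Matrix.posSemidef_self_mul_conjTranspose _
  have hent := vonNeumannEntropy_le_logb hpos htr (K := d ^ (nbhd G (2 * r) A).card) (by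
    rw [hstate, Matrix.rank_self_mul_conjTranspose]
    exact hrank)
  rwa [Nat.cast_pow, Real.logb_pow] at hent

end Schmidt

end QCA

theorem mainTheorem2 (bc : QCA.Boundary) (D d r : ℕ)
    (E : ∀ M : ℕ, QCA.Op (QCA.Site D M) d →ₗ[ℂ] QCA.Op (QCA.Site D M) d)
    (hE : ∀ M : ℕ, 4 ≤ M → 4 * r ≤ M → QCA.IsQCA (QCA.lattice bc D M) r (E M)) :
    ∃ c : ℝ, ∀ M : ℕ, 4 ≤ M → 4 * r ≤ M →
      ∀ (A : Finset (QCA.Site D M)) (ρ : QCA.Op (QCA.Site D M) d),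
        QCA.IsPureProductState ρ →
          QCA.entanglementEntropy A (E M ρ) ≤
            c * (QCA.boundarySize (QCA.lattice bc D M) A : ℝ) := by
  refine ⟨(2 * D + 1) ^ (2 * r) * Real.logb 2 d, fun M hM hrM A ρ hρ => ?_⟩
  have : NeZero M := ⟨by omega⟩
  have hlog : 0 ≤ Real.logb 2 d := by
    rcases Nat.eq_zero_or_pos d with rfl | h
    · simp
    · exact Real.logb_nonneg one_lt_two (by exact_mod_cast h)
  have hcount : ((QCA.nbhd (QCA.lattice bc D M) (2 * r) A).card : ℝ) ≤
      QCA.boundarySize (QCA.lattice bc D M) A * (2 * D + 1) ^ (2 * r) := by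
    exact_mod_cast QCA.card_nbhd_le _ (QCA.card_lattice_neighbours_le bc D M) (2 * r) A
  calc QCA.entanglementEntropy A (E M ρ)
      ≤ (QCA.nbhd (QCA.lattice bc D M) (2 * r) A).card * Real.logb 2 d :=
        QCA.entanglementEntropy_le_card_nbhd (hE M hM hrM) A hρ
    _ ≤ QCA.boundarySize (QCA.lattice bc D M) A * (2 * D + 1) ^ (2 * r) * Real.logb 2 d :=
        mul_le_mul_of_nonneg_right hcount hlog
    _ = _ := by ring
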